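/- Let $K$ be a number field with ring of integers $\overline{R}=\mathcal{O}_K$, and let $R$ be an order in $K$, i.e. a subring of $\mathcal{O}_K$ (with the same identity) containing a $\mathbb{Q}$-basis of $K$; its integral closure is $\overline{R}$. Let $I=(R:\overline{R})=\{a\in\overline{R} : a\overline{R}\subseteq R\}$ be the conductor ideal of $R$, which is an ideal of both $\overline{R}$ and $R$. Write $U(A)$ for the unit group of a ring $A$, and $\mathrm{Cl}(A)$ for the group of invertible fractional ideals of a domain $A$ modulo the principal ones; regard $U(R)$ as a subgroup of $U(\overline{R})$ and $U(R/I)$ as a subgroup of $U(\overline{R}/I)$. Then the groups $U(\overline{R})/U(R)$, $U(\overline{R}/I)$, $U(R/I)$, $\mathrm{Cl}(\overline{R})$ and $\mathrm{Cl}(R)$ are finite, and the following are equivalent. (1) $R$ is a locally associated subring of $\overline{R}$, i.e. there is a group isomorphism $U(\overline{R})/U(R)\cong U(\overline{R}/I)/U(R/I)$. (2) Every coset in $U(\overline{R}/I)/U(R/I)$ contains the residue class of a unit of $\overline{R}$. (2') For every $t\in\overline{R}$ with $t+I\in U(\overline{R}/I)$ there exist $r\in R$ with $r+I\in U(R/I)$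 and $\beta\in I$ such that $tr+\beta\in U(\overline{R})$. (3) For every $t\in\overline{R}$ relatively prime to $I$ (i.e. $t\overline{R}+I=\overline{R}$) there exist $r\in R$ relatively prime to $I$ (i.e. $rR+I=R$) and $u\in U(\overline{R})$ such that $t=ru$. (4) $\left|U(\overline{R})/U(R)\right|=\dfrac{|U(\overline{R}/I)|}{|U(R/I)|}$. (5) $|\mathrm{Cl}(\overline{R})|=|\mathrm{Cl}(R)|$. (6) $\mathrm{Cl}(\overline{R})\cong\mathrm{Cl}(R)$ as groups. -/

import Mathlib

/-- The conductor ideal `(R : T) = {a ∈ T | a T ⊆ R}` of a subring `R` of a commutative ring `T`,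
as an ideal of `T`. -/
def Subring.conductorIdeal {T : Type*} [CommRing T] (R : Subring T) : Ideal T where
  carrier := {a | ∀ b : T, a * b ∈ R}
  zero_mem' b := by simp only [zero_mul, zero_mem]
  add_mem' ha hb c := by simpa only [add_mul] using R.add_mem (ha c) (hb c)
  smul_mem' c a ha b := by simpa only [smul_eq_mul, mul_left_comm, mul_assoc] using ha (c * b)

/-- The conductor ideal is contained in `R`. -/
theorem Subring.mem_of_mem_conductorIdeal {T : Type*} [CommRing T] (R : Subring T) {a : T}
    (ha : a ∈ R.conductorIdeal) : a ∈ R := by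
  simpa only [mul_one] using ha 1

/-- The conductor ideal `(R : T)` regarded as an ideal of `R`
(no element is lost, since `(R : T) ⊆ R`). -/
def Subring.conductorIdealBelow {T : Type*} [CommRing T] (R : Subring T) : Ideal R :=
  R.conductorIdeal.comap R.subtype

/-- The canonical (injective) ring homomorphism `R / I → T / I`, where `I = (R : T)`. -/
def Subring.conductorQuotientMap {T : Type*} [CommRing T] (R : Subring T) :
    R ⧸ R.conductorIdealBelow →+* T ⧸ R.conductorIdeal :=
  Ideal.quotientMap R.conductorIdeal R.subtype le_rfl

/-- `U(R)` as a subgroup of `U(T)`. -/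
def Subring.unitsSubgroup {T : Type*} [CommRing T] (R : Subring T) : Subgroup Tˣ :=
  (Units.map (R.subtype : R →* T)).range

/-- `U(R / I)` as a subgroup of `U(T / I)`, where `I = (R : T)`. -/
def Subring.quotientUnitsSubgroup {T : Type*} [CommRing T] (R : Subring T) :
    Subgroup (T ⧸ R.conductorIdeal)ˣ :=
  (Units.map (R.conductorQuotientMap : R ⧸ R.conductorIdealBelow →* T ⧸ R.conductorIdeal)).range

/-- `R` is a locally associated subring of `T` if the groups `U(T) / U(R)` and
`U(T / I) / U(R / I)` are isomorphic, where `I = (R : T)`. -/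
def Subring.IsLocallyAssociated {T : Type*} [CommRing T] (R : Subring T) : Prop :=
  Nonempty (Tˣ ⧸ R.unitsSubgroup ≃* (T ⧸ R.conductorIdeal)ˣ ⧸ R.quotientUnitsSubgroup)

/-- An order in the number field `K`: a subring of the ring of integers of `K` that contains
a `ℚ`-basis of `K`, that is, spans `K` over `ℚ`. -/
def NumberField.IsOrderIn (K : Type*) [Field K] [NumberField K]
    (R : Subring (NumberField.RingOfIntegers K)) : Prop :=
  Submodule.span ℚ (algebraMap (NumberField.RingOfIntegers K) K '' (R : Set _)) = ⊤

/-! Write `T` for the ring of integers. Two homomorphisms carry the equivalences, and both turn on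
the condition that every `t` prime to `I` factors as `r u`, with `r ∈ R` prime to `I` and `u` a unit
of `T`.

Since `I ⊆ R`, membership in `R` can be tested modulo `I`, so reduction of units induces an
injection `U(T)/U(R) → U(T/I)/U(R/I)` into a finite group (`Subring.unitsQuotientMap_injective`). An
abstract isomorphism and an equality of orders thus both say that this injection is onto; on
elements this is the factorization condition.

Extension of ideals gives `Cl(R) → Cl(T)`. An invertible ideal is principal modulo `I`
(`FractionalIdeal.exists_mul_add_eq_one`), which makes this map surjective and shows that its kernel
consists of the classes of the modules `Rt + I` with `t` prime to `I`. Such a class is trivial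
exactly when `t` factors as above (`Subring.classGroupMap_injective_iff`). The class groups are
finite, so equal class numbers already force injectivity. -/

open scoped nonZeroDivisors

/-- If `A / 𝔪` is finite, then an invertible fractional ideal `J` of `A` contains an element `a`
that generates it modulo `J𝔪`; equivalently, `a b ≡ 1` modulo `𝔪` for some `b ∈ J⁻¹`. -/
theorem FractionalIdeal.exists_mul_add_eq_one {A K : Type*} [CommRing A] [IsDomain A] [Field K]
    [Algebra A K] [IsFractionRing A K] (J : (FractionalIdeal A⁰ K)ˣ) (𝔪 : Ideal A)
    [Finite (A ⧸ 𝔪)] :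
    ∃ a ∈ (J : FractionalIdeal A⁰ K), ∃ b ∈ ((J⁻¹ : (FractionalIdeal A⁰ K)ˣ) :
      FractionalIdeal A⁰ K), ∃ m ∈ 𝔪, a * b + algebraMap A K m = 1 := by
  classical
  have hinj := IsFractionRing.injective A K
  have hint : ∀ a ∈ (J : FractionalIdeal A⁰ K), ∀ b ∈ ((J⁻¹ : (FractionalIdeal A⁰ K)ˣ) :
      FractionalIdeal A⁰ K), ∃ c, algebraMap A K c = a * b := by
    intro a ha b hb
    have := mul_mem_mul ha hb
    rwa [Units.mul_inv, mem_one_iff] at this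
  have hfin : {M : Ideal A | M.IsMaximal ∧ 𝔪 ≤ M}.Finite := by
    refine (Set.finite_range (Ideal.comap (Ideal.Quotient.mk 𝔪))).subset fun M hM ↦ ?_
    refine ⟨M.map (Ideal.Quotient.mk 𝔪), ?_⟩
    rw [Ideal.comap_map_of_surjective _ Ideal.Quotient.mk_surjective, ← RingHom.ker_eq_comap_bot,
      Ideal.mk_ker, sup_eq_left.2 hM.2]
  set s := hfin.toFinset with hs
  have hmem : ∀ {M}, M ∈ s ↔ M.IsMaximal ∧ 𝔪 ≤ M := fun {M} ↦ hfin.mem_toFinset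
  -- If all products `a b` lay in `M`, then so would `1 ∈ J J⁻¹`.
  have hab : ∀ M ∈ s, ∃ a ∈ (J : FractionalIdeal A⁰ K), ∃ b ∈ ((J⁻¹ : (FractionalIdeal A⁰ K)ˣ) :
      FractionalIdeal A⁰ K), ∀ c ∈ M, algebraMap A K c ≠ a * b := by
    intro M hM
    by_contra! h
    have h1 : (1 : K) ∈ ((J : FractionalIdeal A⁰ K) * ((J⁻¹ : (FractionalIdeal A⁰ K)ˣ) :
      FractionalIdeal A⁰ K)) := by
      rw [Units.mul_inv]; exact one_mem_one A⁰
    have : ∃ c ∈ M, algebraMap A K c = 1 := by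
      refine FractionalIdeal.mul_induction_on h1 h ?_
      rintro x y ⟨c, hc, rfl⟩ ⟨d, hd, rfl⟩
      exact ⟨c + d, M.add_mem hc hd, map_add _ _ _⟩
    obtain ⟨c, hc, hc1⟩ := this
    rw [← map_one (algebraMap A K)] at hc1
    exact (M.ne_top_iff_one.1 (hmem.1 hM).1.ne_top) (hinj hc1 ▸ hc)
  -- `M` is comaximal with the intersection of the other ideals in `s`, so it does not contain that
  -- intersection.
  have hu : ∀ M ∈ s, ∃ u ∉ M, ∀ M' ∈ s, M' ≠ M → u ∈ M' := by
    intro M hM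
    have hle : ¬ ⨅ M' ∈ s.erase M, M' ≤ M := by
      refine left_lt_sup.1 ((hmem.1 hM).1.lt_top.trans_eq (Ideal.sup_iInf_eq_top ?_).symm)
      intro M' hM'
      rw [Finset.mem_erase] at hM'
      exact Ideal.IsMaximal.coprime_of_ne (hmem.1 hM).1 (hmem.1 hM'.2).1 hM'.1.symm
    obtain ⟨u, hu, huM⟩ := SetLike.not_le_iff_exists.1 hle
    refine ⟨u, huM, fun M' hM' hne ↦ ?_⟩
    simp only [Submodule.mem_iInf] at hu
    exact hu M' (Finset.mem_erase.2 ⟨hne, hM'⟩)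
  choose! a ha b hb hc using hab
  choose! u huM hu using hu
  choose! c hcab using hint
  -- Modulo `M` only one term of `a M * v` survives, namely `u M * (a M * b M)`, which is outside
  -- `M`. Hence `N = Jv` lies in no maximal ideal above `𝔪`.
  set v := ∑ M ∈ s, u M • b M with hv
  have hvJ : v ∈ ((J⁻¹ : (FractionalIdeal A⁰ K)ˣ) : FractionalIdeal A⁰ K) :=
    Submodule.sum_mem _ fun M hM ↦ Submodule.smul_mem _ _ (hb M hM)
  let N : Ideal A := (((J : FractionalIdeal A⁰ K) : Submodule A K).map
    (LinearMap.mulRight A v)).comap (Algebra.linearMap A K)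
  have htop : N ⊔ 𝔪 = ⊤ := by
    by_contra hne
    obtain ⟨M, hM, hNM⟩ := Ideal.exists_le_maximal _ hne
    have hMs : M ∈ s := hmem.2 ⟨hM, le_sup_right.trans hNM⟩
    have hsum : algebraMap A K (∑ M' ∈ s, u M' * c (a M) (b M')) = a M * v := by
      rw [map_sum, hv, Finset.mul_sum]
      refine Finset.sum_congr rfl fun M' hM' ↦ ?_
      rw [map_mul, hcab _ (ha M hMs) _ (hb M' hM'), Algebra.smul_def]
      ring
    have hN : ∑ M' ∈ s, u M' * c (a M) (b M') ∈ M :=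
      hNM (Ideal.mem_sup_left ⟨a M, ha M hMs, hsum.symm⟩)
    rw [← s.add_sum_erase _ hMs, Ideal.add_mem_iff_left] at hN
    · rcases hM.isPrime.mem_or_mem hN with h | h
      · exact huM M hMs h
      · exact hc M hMs _ h (hcab _ (ha M hMs) _ (hb M hMs))
    · refine Ideal.sum_mem _ fun M' hM' ↦ M.mul_mem_right _ ?_
      rw [Finset.mem_erase] at hM'
      exact hu M' hM'.2 M hMs hM'.1.symm
  obtain ⟨n, ⟨x, hx, hxn⟩, m, hm, hnm⟩ := Submodule.mem_sup.1 ((Ideal.eq_top_iff_one _).1 htop)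
  refine ⟨x, hx, v, hvJ, m, hm, ?_⟩
  rw [← map_one (algebraMap A K), ← hnm, map_add]
  congr 1

/-! ### The modules `Rs + I𝔞` and their inverses -/

section SpanAdd

variable {T K : Type*} [CommRing T] [Field K] [Algebra T K] {R : Subring T} {I : Ideal T}

theorem FractionalIdeal.algebraMap_mul_mem_of_mem_subring {J : FractionalIdeal R⁰ K} {r : T}
    (hr : r ∈ R) {x : K} (hx : x ∈ J) : algebraMap T K r * x ∈ J := by
  have : (⟨r, hr⟩ : R) • x ∈ J := Submodule.smul_mem (J : Submodule R K) _ hx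
  rwa [Algebra.smul_def] at this

theorem FractionalIdeal.exists_algebraMap_eq_of_mem_coeIdeal_mul {𝔞 : (FractionalIdeal T⁰ K)ˣ}
    {x y : K} (hx : x ∈ (I : FractionalIdeal T⁰ K) * 𝔞)
    (hy : y ∈ ((𝔞⁻¹ : (FractionalIdeal T⁰ K)ˣ) : FractionalIdeal T⁰ K)) :
    ∃ i ∈ I, algebraMap T K i = x * y := by
  have := mul_mem_mul hx hy
  rwa [mul_assoc, Units.mul_inv, mul_one, mem_coeIdeal] at this

theorem FractionalIdeal.algebraMap_mul_mem_coeIdeal_mul {𝔞 : FractionalIdeal T⁰ K} {i : T}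
    (hi : i ∈ I) {x : K} (hx : x ∈ 𝔞) : algebraMap T K i * x ∈ (I : FractionalIdeal T⁰ K) * 𝔞 :=
  mul_mem_mul ((mem_coeIdeal _).2 ⟨i, hi, rfl⟩) hx

theorem FractionalIdeal.coeIdeal_mul_subset (𝔞 : FractionalIdeal T⁰ K) :
    (I : FractionalIdeal T⁰ K) * 𝔞 ≤ 𝔞 :=
  (mul_le_mul_left coeIdeal_le_one 𝔞).trans_eq (one_mul 𝔞)

variable (R I) in
/-- The `R`-submodule `Rs + I𝔞` of `K`, for a fractional ideal `𝔞` of `T`. -/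
def FractionalIdeal.spanAddCoeIdealMul (s : K) (𝔞 : FractionalIdeal T⁰ K) : Submodule R K :=
  Submodule.span R {s} ⊔ (((I : FractionalIdeal T⁰ K) * 𝔞 : FractionalIdeal T⁰ K) :
    Submodule T K).restrictScalars R

theorem FractionalIdeal.mem_spanAddCoeIdealMul {s x : K} {𝔞 : FractionalIdeal T⁰ K} :
    x ∈ spanAddCoeIdealMul R I s 𝔞 ↔
      ∃ r ∈ R, ∃ y ∈ (I : FractionalIdeal T⁰ K) * 𝔞, x = algebraMap T K r * s + y := by
  rw [spanAddCoeIdealMul, Submodule.mem_sup]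
  constructor
  · rintro ⟨_, hz, y, hy, rfl⟩
    obtain ⟨r, rfl⟩ := Submodule.mem_span_singleton.1 hz
    exact ⟨r, r.2, y, hy, by rw [Algebra.smul_def]; rfl⟩
  · rintro ⟨r, hr, y, hy, rfl⟩
    refine ⟨_, Submodule.mem_span_singleton.2 ⟨⟨r, hr⟩, rfl⟩, y, hy, ?_⟩
    rw [Algebra.smul_def]; rfl

theorem FractionalIdeal.spanAddCoeIdealMul_subset {s x : K} {𝔞 : FractionalIdeal T⁰ K} (hs : s ∈ 𝔞)
    (hx : x ∈ spanAddCoeIdealMul R I s 𝔞) : x ∈ 𝔞 := by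
  obtain ⟨r, -, y, hy, rfl⟩ := mem_spanAddCoeIdealMul.1 hx
  rw [← Algebra.smul_def]
  exact Submodule.add_mem (𝔞 : Submodule T K) (Submodule.smul_mem _ _ hs)
    (coeIdeal_mul_subset 𝔞 hy)

/-- Products of generators lie in `R` because `s t = 1 - m` and all the other terms lie in `I ⊆ R`.
Conversely, `1` is recovered from `s t + m = 1` by multiplying the error term `m` by the same
relation. -/
theorem FractionalIdeal.spanAddCoeIdealMul_mul_eq_one (hI : ∀ a ∈ I, a ∈ R)
    {𝔞 : (FractionalIdeal T⁰ K)ˣ} {s t : K} {m : T} (hs : s ∈ (𝔞 : FractionalIdeal T⁰ K))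
    (ht : t ∈ ((𝔞⁻¹ : (FractionalIdeal T⁰ K)ˣ) : FractionalIdeal T⁰ K)) (hm : m ∈ I)
    (hst : s * t + algebraMap T K m = 1) :
    spanAddCoeIdealMul R I s (𝔞 : FractionalIdeal T⁰ K) *
      spanAddCoeIdealMul R I t ((𝔞⁻¹ : (FractionalIdeal T⁰ K)ˣ) : FractionalIdeal T⁰ K) = 1 := by
  apply le_antisymm
  · refine Submodule.mul_le.2 fun x hx y hy ↦ ?_
    rw [Submodule.mem_one]
    suffices h : ∃ r ∈ R, algebraMap T K r = x * y by
      obtain ⟨r, hr, h⟩ := h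
      exact ⟨⟨r, hr⟩, h⟩
    have hy' := spanAddCoeIdealMul_subset ht hy
    obtain ⟨r, hr, x', hx', rfl⟩ := mem_spanAddCoeIdealMul.1 hx
    obtain ⟨q, hq, y', hyI, rfl⟩ := mem_spanAddCoeIdealMul.1 hy
    obtain ⟨i, hi, hi'⟩ := exists_algebraMap_eq_of_mem_coeIdeal_mul hx' hy'
    obtain ⟨j, hj, hj'⟩ := exists_algebraMap_eq_of_mem_coeIdeal_mul (𝔞 := 𝔞⁻¹) hyI
      (by rwa [inv_inv])
    -- Here `1 - m` is `s t`, `j` is `s y'`, and `i` is `x'` times the whole second factor.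
    refine ⟨r * q * (1 - m) + r * j + i, ?_, ?_⟩
    · exact R.add_mem (R.add_mem (R.mul_mem (R.mul_mem hr hq) (R.sub_mem R.one_mem (hI _ hm)))
        (R.mul_mem hr (hI _ hj))) (hI _ hi)
    · simp only [map_add, map_mul, map_sub, map_one, hi', hj']
      linear_combination (-(algebraMap T K r * algebraMap T K q)) * hst
  · rw [Submodule.one_le]
    set J := spanAddCoeIdealMul R I s (𝔞 : FractionalIdeal T⁰ K)
    set J' := spanAddCoeIdealMul R I t ((𝔞⁻¹ : (FractionalIdeal T⁰ K)ˣ) : FractionalIdeal T⁰ K)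
    have hsJ : s ∈ J := Submodule.mem_sup_left (Submodule.mem_span_singleton_self s)
    have htJ : t ∈ J' := Submodule.mem_sup_left (Submodule.mem_span_singleton_self t)
    have hmJ : ∀ x ∈ (𝔞 : FractionalIdeal T⁰ K), algebraMap T K m * x ∈ J := fun x hx ↦
      Submodule.mem_sup_right (algebraMap_mul_mem_coeIdeal_mul hm hx)
    have hmJ' : ∀ x ∈ ((𝔞⁻¹ : (FractionalIdeal T⁰ K)ˣ) : FractionalIdeal T⁰ K),
        algebraMap T K m * x ∈ J' := fun x hx ↦
      Submodule.mem_sup_right (algebraMap_mul_mem_coeIdeal_mul hm hx)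
    have h1 : (1 : K) ∈ ((𝔞 : FractionalIdeal T⁰ K) * ((𝔞⁻¹ : (FractionalIdeal T⁰ K)ˣ) :
      FractionalIdeal T⁰ K)) := by
      rw [Units.mul_inv]; exact one_mem_one T⁰
    -- Write `1` as a sum of products `x y` from `𝔞` and `𝔞⁻¹` and give one factor `m` to each of
    -- `x` and `y`.
    have hmm : algebraMap T K m * algebraMap T K m * 1 ∈ J * J' := by
      refine FractionalIdeal.mul_induction_on
        (C := fun z ↦ algebraMap T K m * algebraMap T K m * z ∈ J * J') h1 ?_ ?_
      · intro x hx y hy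
        rw [mul_mul_mul_comm]
        exact Submodule.mul_mem_mul (hmJ x hx) (hmJ' y hy)
      · intro x y hx hy
        rw [mul_add]
        exact Submodule.add_mem _ hx hy
    have : (1 : K) = s * t + (s * (algebraMap T K m * t) +
        algebraMap T K m * algebraMap T K m * 1) := by
      linear_combination (-1 - algebraMap T K m) * hst
    rw [this]
    exact Submodule.add_mem _ (Submodule.mul_mem_mul hsJ htJ)
      (Submodule.add_mem _ (Submodule.mul_mem_mul hsJ (hmJ' t ht)) hmm)

end SpanAdd

/-! ### Extension of invertible fractional ideals from `R` to `T` -/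

section Extension

variable {T K : Type*} [CommRing T] [IsDomain T] [Field K] [Algebra T K] [IsFractionRing T K]
  {R : Subring T} [IsFractionRing R K]

/-- The two rings share the fraction field `K`, so the map induced on `K` by the inclusion is the
identity. -/
theorem FractionalIdeal.coe_extendedHom_subring (J : FractionalIdeal R⁰ K) :
    (FractionalIdeal.extendedHom K T J : Submodule T K) = Submodule.span T (J : Set K) := by
  have hid : IsLocalization.map K (algebraMap R T)
      (nonZeroDivisors_le_comap_nonZeroDivisors_of_injective _
        (FaithfulSMul.algebraMap_injective R T)) = RingHom.id K := by
    refine IsLocalization.ringHom_ext R⁰ ?_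
    ext x
    simp only [RingHom.comp_apply, IsLocalization.map_eq, RingHom.id_apply]
    rfl
  rw [FractionalIdeal.extendedHom'_apply, FractionalIdeal.coe_extended_eq_span, hid]
  simp

theorem FractionalIdeal.extendedHom_subring_spanSingleton (x : K) :
    FractionalIdeal.extendedHom K T (FractionalIdeal.spanSingleton R⁰ x) =
      FractionalIdeal.spanSingleton T⁰ x := by
  rw [← FractionalIdeal.coeToSubmodule_inj, coe_extendedHom_subring]
  simp only [coe_spanSingleton]
  refine le_antisymm (Submodule.span_le.2 fun y hy ↦ ?_)
    (Submodule.span_le.2 (Set.singleton_subset_iff.2 (Submodule.subset_span ?_)))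
  · obtain ⟨r, rfl⟩ := (mem_spanSingleton R⁰).1 hy
    exact Submodule.smul_mem _ (r : T) (Submodule.mem_span_singleton_self x)
  · exact mem_spanSingleton_self R⁰ x

theorem FractionalIdeal.mem_extendedHom_subring {J : FractionalIdeal R⁰ K} {x : K} (hx : x ∈ J) :
    x ∈ FractionalIdeal.extendedHom K T J := by
  rw [← FractionalIdeal.mem_coe, coe_extendedHom_subring]
  exact Submodule.subset_span hx

variable (T) in
/-- Extension of invertible fractional ideals from a subring `R` of `T` to `T`, both with field of
fractions `K`. -/
noncomputable def FractionalIdeal.extendUnits :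
    (FractionalIdeal R⁰ K)ˣ →* (FractionalIdeal T⁰ K)ˣ :=
  Units.map
    (FractionalIdeal.extendedHom K T : FractionalIdeal R⁰ K →+* FractionalIdeal T⁰ K).toMonoidHom

theorem FractionalIdeal.coe_extendUnits (J : (FractionalIdeal R⁰ K)ˣ) :
    (extendUnits T J : FractionalIdeal T⁰ K) = extendedHom K T (J : FractionalIdeal R⁰ K) :=
  rfl

theorem FractionalIdeal.extendUnits_toPrincipalIdeal (x : Kˣ) :
    extendUnits T (toPrincipalIdeal R K x) = toPrincipalIdeal T K x := by
  ext1
  rw [coe_extendUnits, coe_toPrincipalIdeal, coe_toPrincipalIdeal,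
    extendedHom_subring_spanSingleton]

variable {I : Ideal T}

/-- An invertible fractional ideal `J` of `R` that extends to the unit ideal of `T` is of the form
`Rt + I`, with `t ∈ T` prime to `I`. -/
theorem FractionalIdeal.exists_mem_iff_of_extendUnits_eq_one (hI : ∀ a ∈ I, a ∈ R) [Finite (T ⧸ I)]
    {J : (FractionalIdeal R⁰ K)ˣ} (hJ : extendUnits T J = 1) :
    ∃ t : T, Ideal.span {t} ⊔ I = ⊤ ∧ ∀ x : K, x ∈ (J : FractionalIdeal R⁰ K) ↔
      ∃ r ∈ R, ∃ i ∈ I, x = algebraMap T K (r * t + i) := by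
  have hT : ∀ {J : (FractionalIdeal R⁰ K)ˣ}, extendUnits T J = 1 →
      ∀ x ∈ (J : FractionalIdeal R⁰ K), ∃ y : T, algebraMap T K y = x := by
    intro J hJ x hx
    have := mem_extendedHom_subring hx
    rwa [← coe_extendUnits, hJ, Units.val_one, mem_one_iff] at this
  have hinj := IsFractionRing.injective T K
  have hJ' : extendUnits T J⁻¹ = 1 := by rw [map_inv, hJ, inv_one]
  have : Finite (R ⧸ I.comap R.subtype) :=
    Finite.of_injective _ (Ideal.quotientMap_injective (I := I) (f := R.subtype))
  obtain ⟨a, ha, b, hb, m, hm, habm⟩ := exists_mul_add_eq_one J (I.comap R.subtype)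
  obtain ⟨t, rfl⟩ := hT hJ a ha
  obtain ⟨s, rfl⟩ := hT hJ' b hb
  have hts : t * s + (m : T) = 1 := by
    apply hinj
    rw [map_add, map_mul, map_one]
    exact habm
  -- Expand `1 ∈ J J⁻¹`: since `J⁻¹ ⊆ T`, each `i x y` equals `(i y) x` with `i y ∈ I ⊆ R`.
  have hIJ : ∀ i ∈ I, algebraMap T K i ∈ (J : FractionalIdeal R⁰ K) := by
    intro i hi
    have h1 : (1 : K) ∈ ((J : FractionalIdeal R⁰ K) * ((J⁻¹ : (FractionalIdeal R⁰ K)ˣ) :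
      FractionalIdeal R⁰ K)) := by
      rw [Units.mul_inv]; exact one_mem_one R⁰
    rw [← mul_one (algebraMap T K i)]
    refine FractionalIdeal.mul_induction_on
      (C := fun y ↦ algebraMap T K i * y ∈ (J : FractionalIdeal R⁰ K)) h1 ?_ ?_
    · intro x hx y hy
      obtain ⟨z, rfl⟩ := hT hJ' y hy
      have := algebraMap_mul_mem_of_mem_subring (hI _ (I.mul_mem_right z hi)) hx
      rwa [map_mul, mul_assoc, mul_comm _ x] at this
    · intro x y hx hy
      rw [mul_add]
      exact Submodule.add_mem _ hx hy
  refine ⟨t, ?_, fun x ↦ ⟨fun hx ↦ ?_, ?_⟩⟩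
  · rw [Ideal.eq_top_iff_one, ← hts]
    exact Ideal.add_mem _ (Ideal.mem_sup_left (Ideal.mul_mem_right _ _
      (Ideal.mem_span_singleton_self t))) (Ideal.mem_sup_right hm)
  · have hxs := mul_mem_mul hx hb
    rw [Units.mul_inv, mem_one_iff] at hxs
    obtain ⟨r, hr⟩ := hxs
    obtain ⟨y, rfl⟩ := hT hJ x hx
    have hr' : (r : T) = y * s := hinj (by rw [map_mul]; exact hr)
    -- `y = y (t s + m) = (y s) t + y m`, where `y s ∈ J J⁻¹ = R`.
    refine ⟨r, r.2, y * m, I.mul_mem_left _ hm, congrArg _ ?_⟩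
    rw [hr']
    linear_combination (-y) * hts
  · rintro ⟨r, hr, i, hi, rfl⟩
    rw [map_add]
    refine Submodule.add_mem _ ?_ (hIJ i hi)
    rw [map_mul]
    exact algebraMap_mul_mem_of_mem_subring hr ha

/-- If `s ∈ 𝔞` and `t ∈ 𝔞⁻¹` satisfy `s t ≡ 1` modulo `I`, then `Rs + I𝔞` is an invertible
fractional ideal of `R` that extends to `𝔞`. -/
theorem FractionalIdeal.exists_extendUnits_eq_of_mul_add_eq_one (hI : ∀ a ∈ I, a ∈ R)
    {𝔞 : (FractionalIdeal T⁰ K)ˣ} {s t : K} {m : T} (hs : s ∈ (𝔞 : FractionalIdeal T⁰ K))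
    (ht : t ∈ ((𝔞⁻¹ : (FractionalIdeal T⁰ K)ˣ) : FractionalIdeal T⁰ K)) (hm : m ∈ I)
    (hst : s * t + algebraMap T K m = 1) :
    ∃ J : (FractionalIdeal R⁰ K)ˣ, extendUnits T J = 𝔞 ∧
      ((J : FractionalIdeal R⁰ K) : Submodule R K) = spanAddCoeIdealMul R I s 𝔞 := by
  have h := spanAddCoeIdealMul_mul_eq_one hI hs ht hm hst
  let J : (FractionalIdeal R⁰ K)ˣ := unitsMulEquivSubmodule.symm (Units.mkOfMulEqOne _ _ h)
  have hJ : ((J : FractionalIdeal R⁰ K) : Submodule R K) = spanAddCoeIdealMul R I s 𝔞 := rfl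
  have hJ' : ∀ x, x ∈ (J : FractionalIdeal R⁰ K) ↔ x ∈ spanAddCoeIdealMul R I s 𝔞 :=
    fun x ↦ Iff.rfl
  refine ⟨J, ?_, hJ⟩
  ext1
  rw [coe_extendUnits, ← FractionalIdeal.coeToSubmodule_inj, coe_extendedHom_subring]
  refine le_antisymm (Submodule.span_le.2 fun x hx ↦ spanAddCoeIdealMul_subset hs hx) ?_
  intro x hx
  have hxt := mul_mem_mul hx ht
  rw [Units.mul_inv, mem_one_iff] at hxt
  obtain ⟨y, hy⟩ := hxt
  -- Here `y = x t ∈ T`, so `y s` is in the `T`-span of `s`, while `m x ∈ I𝔞`.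
  have : x = y • s + algebraMap T K m * x := by
    rw [Algebra.smul_def, hy]
    linear_combination (-x) * hst
  rw [this]
  refine Submodule.add_mem _ (Submodule.smul_mem _ _ (Submodule.subset_span ?_))
    (Submodule.subset_span ?_)
  · exact Submodule.mem_sup_left (Submodule.mem_span_singleton_self s)
  · exact Submodule.mem_sup_right (algebraMap_mul_mem_coeIdeal_mul hm hx)

theorem FractionalIdeal.extendUnits_surjective (hI : ∀ a ∈ I, a ∈ R) [Finite (T ⧸ I)] :
    Function.Surjective (extendUnits T : (FractionalIdeal R⁰ K)ˣ → (FractionalIdeal T⁰ K)ˣ) := by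
  intro 𝔞
  obtain ⟨s, hs, t, ht, m, hm, hst⟩ := exists_mul_add_eq_one 𝔞 I
  obtain ⟨J, hJ, -⟩ := exists_extendUnits_eq_of_mul_add_eq_one hI hs ht hm hst
  exact ⟨J, hJ⟩

/-- For `t ∈ T` prime to `I`, `Rt + I` is an invertible fractional ideal of `R` that extends to the
unit ideal of `T`. -/
theorem FractionalIdeal.exists_extendUnits_eq_one (hI : ∀ a ∈ I, a ∈ R) {t : T}
    (ht : Ideal.span {t} ⊔ I = ⊤) :
    ∃ J : (FractionalIdeal R⁰ K)ˣ, extendUnits T J = 1 ∧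
      ∀ x : K, x ∈ (J : FractionalIdeal R⁰ K) ↔
        ∃ r ∈ R, ∃ i ∈ I, x = algebraMap T K (r * t + i) := by
  obtain ⟨_, hts, m, hm, h⟩ := Submodule.mem_sup.1 ((Ideal.eq_top_iff_one _).1 ht)
  obtain ⟨s, rfl⟩ := Ideal.mem_span_singleton'.1 hts
  obtain ⟨J, hJ, hJ'⟩ := exists_extendUnits_eq_of_mul_add_eq_one (K := K) (𝔞 := 1)
    (s := algebraMap T K t) (t := algebraMap T K s) hI
    (by rw [Units.val_one]; exact coe_mem_one T⁰ t)
    (by rw [inv_one, Units.val_one]; exact coe_mem_one T⁰ s) hm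
    (by rw [← map_mul, ← map_add, mul_comm, h, map_one])
  refine ⟨J, hJ, fun x ↦ ?_⟩
  rw [← FractionalIdeal.mem_coe, hJ', mem_spanAddCoeIdealMul]
  simp only [Units.val_one, mul_one, mem_coeIdeal, map_add, map_mul]
  constructor
  · rintro ⟨r, hr, _, ⟨i, hi, rfl⟩, rfl⟩
    exact ⟨r, hr, i, hi, rfl⟩
  · rintro ⟨r, hr, i, hi, rfl⟩
    exact ⟨r, hr, _, ⟨i, hi, rfl⟩, rfl⟩

end Extension

/-! ### The map `Cl(R) → Cl(T)`: surjectivity, finite kernel, injectivity -/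

section ClassGroup

variable (K : Type*) {T : Type*} [CommRing T] [IsDomain T] [Field K] [Algebra T K]
  [IsFractionRing T K] (R : Subring T) [IsFractionRing R K]

/-- The homomorphism `Cl(R) → Cl(T)` given by extension of ideals, for a subring `R` of `T` with the
same field of fractions `K`. -/
noncomputable def Subring.classGroupMap : ClassGroup R →* ClassGroup T :=
  (ClassGroup.equiv K).symm.toMonoidHom.comp <|
    (QuotientGroup.map (toPrincipalIdeal R K).range (toPrincipalIdeal T K).range
      (FractionalIdeal.extendUnits T) (by
        rintro _ ⟨x, rfl⟩
        exact ⟨x, (FractionalIdeal.extendUnits_toPrincipalIdeal x).symm⟩)).comp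
    (ClassGroup.equiv K).toMonoidHom

theorem Subring.classGroupMap_equiv_symm_mk (J : (FractionalIdeal R⁰ K)ˣ) :
    R.classGroupMap K ((ClassGroup.equiv K).symm (QuotientGroup.mk J)) =
      (ClassGroup.equiv K).symm (QuotientGroup.mk (FractionalIdeal.extendUnits T J)) := by
  simp [classGroupMap]

theorem ClassGroup.equiv_symm_mk_surjective {A : Type*} [CommRing A] [IsDomain A] [Algebra A K]
    [IsFractionRing A K] (c : ClassGroup A) :
    ∃ J : (FractionalIdeal A⁰ K)ˣ, (ClassGroup.equiv K).symm (QuotientGroup.mk J) = c := by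
  obtain ⟨J, hJ⟩ := QuotientGroup.mk_surjective (ClassGroup.equiv K c)
  exact ⟨J, by rw [hJ, MulEquiv.symm_apply_apply]⟩

theorem ClassGroup.equiv_symm_mk_eq_one_iff {A : Type*} [CommRing A] [IsDomain A] [Algebra A K]
    [IsFractionRing A K] (J : (FractionalIdeal A⁰ K)ˣ) :
    (ClassGroup.equiv K).symm (QuotientGroup.mk J) = 1 ↔ ∃ x, toPrincipalIdeal A K x = J := by
  rw [EmbeddingLike.map_eq_one_iff, QuotientGroup.eq_one_iff, MonoidHom.mem_range]

/-- A representative extending to `xT` can be divided by `xR` without changing its class. -/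
theorem Subring.exists_of_classGroupMap_eq_one {c : ClassGroup R} (hc : R.classGroupMap K c = 1) :
    ∃ J : (FractionalIdeal R⁰ K)ˣ, (ClassGroup.equiv K).symm (QuotientGroup.mk J) = c ∧
      FractionalIdeal.extendUnits T J = 1 := by
  obtain ⟨J, rfl⟩ := ClassGroup.equiv_symm_mk_surjective K c
  rw [classGroupMap_equiv_symm_mk, ClassGroup.equiv_symm_mk_eq_one_iff] at hc
  obtain ⟨x, hx⟩ := hc
  refine ⟨J * (toPrincipalIdeal R K x)⁻¹, ?_, ?_⟩
  · congr 1
    rw [QuotientGroup.eq]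
    exact ⟨x, by simp⟩
  · rw [map_mul, map_inv, FractionalIdeal.extendUnits_toPrincipalIdeal, hx, mul_inv_cancel]

variable {R} {I : Ideal T} (hI : ∀ a ∈ I, a ∈ R)
include hI

theorem Subring.classGroupMap_surjective [Finite (T ⧸ I)] :
    Function.Surjective (R.classGroupMap K) := by
  intro c
  obtain ⟨𝔞, rfl⟩ := ClassGroup.equiv_symm_mk_surjective K c
  obtain ⟨J, rfl⟩ := FractionalIdeal.extendUnits_surjective (K := K) hI 𝔞
  exact ⟨_, R.classGroupMap_equiv_symm_mk K J⟩

/-- A kernel class is represented by some `Rt + I`, which depends only on `t` modulo `I`, and `T/I`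
is finite. -/
theorem Subring.finite_ker_classGroupMap [Finite (T ⧸ I)] :
    Finite (R.classGroupMap K).ker := by
  choose f hf using fun c : (R.classGroupMap K).ker ↦
    exists_of_classGroupMap_eq_one K R c.2
  choose t ht hft using fun c : (R.classGroupMap K).ker ↦
    FractionalIdeal.exists_mem_iff_of_extendUnits_eq_one hI (hf c).2
  refine Finite.of_injective (fun c ↦ Ideal.Quotient.mk I (t c)) fun c d hcd ↦ ?_
  rw [Ideal.Quotient.eq] at hcd
  have hle : ∀ {c d}, t c - t d ∈ I → (f c : FractionalIdeal R⁰ K) ≤ f d := by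
    intro c d hcd x hx
    obtain ⟨r, hr, i, hi, rfl⟩ := (hft c x).1 hx
    exact (hft d _).2 ⟨r, hr, r * (t c - t d) + i, I.add_mem (I.mul_mem_left _ hcd) hi,
      by congr 1; ring⟩
  have : f c = f d :=
    Units.ext (le_antisymm (hle hcd) (hle (by rw [← neg_sub]; exact I.neg_mem hcd)))
  ext1
  rw [← (hf c).1, ← (hf d).1, this]

include K in
theorem Subring.finite_classGroup [Finite (T ⧸ I)] [Finite (ClassGroup T)] :
    Finite (ClassGroup R) := by
  have := finite_ker_classGroupMap K hI
  have : Finite (ClassGroup R ⧸ (R.classGroupMap K).ker) :=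
    Finite.of_injective _ (QuotientGroup.kerLift_injective (R.classGroupMap K))
  exact Finite.of_subgroup_quotient (R.classGroupMap K).ker

/-- `Cl(R) → Cl(T)` is injective if and only if every element of `T` prime to `I` is the product of
an element of `R` prime to `I` and a unit of `T`. -/
theorem Subring.classGroupMap_injective_iff [Finite (T ⧸ I)] :
    Function.Injective (R.classGroupMap K) ↔
      ∀ t : T, Ideal.span {t} ⊔ I = ⊤ →
        ∃ r : R, Ideal.span {r} ⊔ I.comap R.subtype = ⊤ ∧ ∃ u : Tˣ, t = (r : T) * u := by
  have hK := IsFractionRing.injective T K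
  rw [injective_iff_map_eq_one]
  constructor
  · intro h t ht
    obtain ⟨J, hJ, hmem⟩ := FractionalIdeal.exists_extendUnits_eq_one (K := K) hI ht
    have h1 := h ((ClassGroup.equiv K).symm (QuotientGroup.mk J)) (by
      rw [classGroupMap_equiv_symm_mk, hJ, QuotientGroup.mk_one, map_one])
    obtain ⟨x, hx⟩ := (ClassGroup.equiv_symm_mk_eq_one_iff K J).1 h1
    -- `J = xR` extends both to `xT` and to `T`, so its generator is a unit of `T`.
    obtain ⟨u, hu⟩ : ∃ u : Tˣ, (x : K) = algebraMap T K u := by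
      rw [← Submodule.span_singleton_eq_one_iff, ← FractionalIdeal.coe_spanSingleton T⁰,
        ← coe_toPrincipalIdeal, ← FractionalIdeal.extendUnits_toPrincipalIdeal (R := R), hx, hJ,
        Units.val_one, FractionalIdeal.coe_one]
    rw [toPrincipalIdeal_eq_iff] at hx
    obtain ⟨r, hr⟩ : ∃ r : R, r • (x : K) = algebraMap T K t := by
      rw [← FractionalIdeal.mem_spanSingleton R⁰, hx]
      exact (hmem _).2 ⟨1, R.one_mem, 0, I.zero_mem, by simp⟩
    -- The generator itself lies in `Rt + I`: `u = a t + i` with `t = r u`. Dividing by `u` gives `1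
    -- = a r + i u⁻¹`, so `r` is prime to `I`.
    obtain ⟨a, ha, i, hi, hx'⟩ := (hmem x).1 (by
      rw [← hx]; exact FractionalIdeal.mem_spanSingleton_self R⁰ _)
    have htr : t = r * u := by
      apply hK
      rw [← hr, hu, Algebra.smul_def, map_mul]
      rfl
    have hu' : (u : T) = a * t + i := hK (hu ▸ hx')
    have hiu : i * ((u⁻¹ : Tˣ) : T) ∈ I := I.mul_mem_right _ hi
    refine ⟨r, ?_, u, htr⟩
    rw [Ideal.eq_top_iff_one]
    have : (1 : R) = ⟨a, ha⟩ * r + ⟨i * ((u⁻¹ : Tˣ) : T), hI _ hiu⟩ := by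
      ext1
      push_cast
      have h1 := u.mul_inv
      rw [htr] at hu'
      linear_combination (((u⁻¹ : Tˣ) : T)) * hu' + (a * r - 1) * h1
    rw [this]
    exact Ideal.add_mem _ (Ideal.mem_sup_left (Ideal.mul_mem_left _ _
      (Ideal.mem_span_singleton_self r))) (Ideal.mem_sup_right hiu)
  · intro h c hc
    obtain ⟨J, rfl, hJ⟩ := exists_of_classGroupMap_eq_one K R hc
    obtain ⟨t, ht, hmem⟩ := FractionalIdeal.exists_mem_iff_of_extendUnits_eq_one hI hJ
    obtain ⟨r, hr, u, rfl⟩ := h t ht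
    obtain ⟨_, har, j, hj, h1⟩ := Submodule.mem_sup.1 ((Ideal.eq_top_iff_one _).1 hr)
    obtain ⟨a, rfl⟩ := Ideal.mem_span_singleton'.1 har
    have h1' : (a : T) * r + j = 1 := congrArg Subtype.val h1
    rw [ClassGroup.equiv_symm_mk_eq_one_iff]
    -- `Rru + I = Ru`: from `a r + j = 1` one gets `u = a (r u) + u j`, and `i = (i u⁻¹) u` with `i
    -- u⁻¹ ∈ I ⊆ R`.
    refine ⟨Units.map (algebraMap T K).toMonoidHom u, ?_⟩
    rw [toPrincipalIdeal_eq_iff]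
    ext x
    rw [FractionalIdeal.mem_spanSingleton, hmem]
    constructor
    · rintro ⟨q, rfl⟩
      refine ⟨q * a, (q * a).2, q * u * j, I.mul_mem_left _ hj, ?_⟩
      rw [Algebra.smul_def]
      change algebraMap T K q * algebraMap T K u = _
      rw [← map_mul]
      congr 1
      linear_combination (-(q * u : T)) * h1'
    · rintro ⟨q, hq, i, hi, rfl⟩
      have hiu : i * ((u⁻¹ : Tˣ) : T) ∈ I := I.mul_mem_right _ hi
      refine ⟨⟨q * r + i * ((u⁻¹ : Tˣ) : T), R.add_mem (R.mul_mem hq r.2) (hI _ hiu)⟩, ?_⟩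
      rw [Algebra.smul_def]
      change algebraMap T K (q * r + i * ((u⁻¹ : Tˣ) : T)) * algebraMap T K u = _
      rw [← map_mul]
      congr 1
      linear_combination i * u.inv_mul

end ClassGroup

/-! ### Units modulo the conductor -/

section Units

variable {T : Type*} [CommRing T] (R : Subring T)

theorem Subring.mem_unitsSubgroup_iff {u : Tˣ} :
    u ∈ R.unitsSubgroup ↔ (u : T) ∈ R ∧ ((u⁻¹ : Tˣ) : T) ∈ R := by
  constructor
  · rintro ⟨v, rfl⟩
    exact ⟨(v : R).2, ((v⁻¹ : Rˣ) : R).2⟩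
  · rintro ⟨h, h'⟩
    exact ⟨⟨⟨u, h⟩, ⟨_, h'⟩, Subtype.ext u.mul_inv, Subtype.ext u.inv_mul⟩, Units.ext rfl⟩

theorem Subring.conductorQuotientMap_injective : Function.Injective R.conductorQuotientMap :=
  Ideal.quotientMap_injective

theorem Subring.card_quotientUnitsSubgroup :
    Nat.card R.quotientUnitsSubgroup = Nat.card (R ⧸ R.conductorIdealBelow)ˣ :=
  (Nat.card_congr (MonoidHom.ofInjective
    (Units.map_injective R.conductorQuotientMap_injective)).toEquiv).symm

/-- Reduction of units modulo the conductor. -/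
def Subring.unitsReduction : Tˣ →* (T ⧸ R.conductorIdeal)ˣ :=
  Units.map (Ideal.Quotient.mk R.conductorIdeal : T →* T ⧸ R.conductorIdeal)

theorem Subring.mem_of_conductorQuotientMap_eq_mk {t : T} {q : R ⧸ R.conductorIdealBelow}
    (h : R.conductorQuotientMap q = Ideal.Quotient.mk R.conductorIdeal t) : t ∈ R := by
  obtain ⟨r, rfl⟩ := Ideal.Quotient.mk_surjective q
  change Ideal.Quotient.mk R.conductorIdeal r = _ at h
  rw [eq_comm, Ideal.Quotient.eq] at h
  simpa using R.add_mem (R.mem_of_mem_conductorIdeal h) r.2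

/-- A unit whose class comes from `U(R/I)` lies in `R` along with its inverse, because `I ⊆ R`. This
yields both the existence and the injectivity of `unitsQuotientMap`. -/
theorem Subring.comap_unitsReduction_quotientUnitsSubgroup :
    R.quotientUnitsSubgroup.comap R.unitsReduction = R.unitsSubgroup := by
  ext u
  rw [Subgroup.mem_comap, mem_unitsSubgroup_iff]
  constructor
  · rintro ⟨v, hv⟩
    exact ⟨R.mem_of_conductorQuotientMap_eq_mk (congrArg Units.val hv),
      R.mem_of_conductorQuotientMap_eq_mk (q := ((v⁻¹ : (R ⧸ R.conductorIdealBelow)ˣ) : _))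
        (congrArg (fun w : (T ⧸ R.conductorIdeal)ˣ ↦ ((w⁻¹ : (T ⧸ R.conductorIdeal)ˣ) :
          T ⧸ R.conductorIdeal)) hv)⟩
  · rintro ⟨h, h'⟩
    refine ⟨Units.map (Ideal.Quotient.mk R.conductorIdealBelow).toMonoidHom
      ⟨⟨u, h⟩, ⟨_, h'⟩, Subtype.ext u.mul_inv, Subtype.ext u.inv_mul⟩, Units.ext rfl⟩

/-- The homomorphism `U(T)/U(R) → U(T/I)/U(R/I)`, where `I = (R : T)`. -/
def Subring.unitsQuotientMap :
    Tˣ ⧸ R.unitsSubgroup →* (T ⧸ R.conductorIdeal)ˣ ⧸ R.quotientUnitsSubgroup :=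
  QuotientGroup.map _ _ R.unitsReduction R.comap_unitsReduction_quotientUnitsSubgroup.ge

theorem Subring.unitsQuotientMap_injective : Function.Injective R.unitsQuotientMap := by
  rw [injective_iff_map_eq_one]
  rintro ⟨u⟩ hu
  change QuotientGroup.mk (R.unitsReduction u) = (1 : _ ⧸ R.quotientUnitsSubgroup) at hu
  rw [QuotientGroup.eq_one_iff, ← Subgroup.mem_comap,
    comap_unitsReduction_quotientUnitsSubgroup] at hu
  exact (QuotientGroup.eq_one_iff u).2 hu

theorem Subring.unitsQuotientMap_surjective_iff :
    Function.Surjective R.unitsQuotientMap ↔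
      ∀ c : (T ⧸ R.conductorIdeal)ˣ ⧸ R.quotientUnitsSubgroup,
        ∃ u : Tˣ, QuotientGroup.mk (R.unitsReduction u) = c := by
  refine forall_congr' fun c ↦ ⟨?_, fun ⟨u, hu⟩ ↦ ⟨QuotientGroup.mk u, hu⟩⟩
  rintro ⟨⟨u⟩, hu⟩
  exact ⟨u, hu⟩

theorem Ideal.Quotient.isUnit_mk_iff {A : Type*} [CommRing A] {I : Ideal A} {a : A} :
    IsUnit (Ideal.Quotient.mk I a) ↔ Ideal.span {a} ⊔ I = ⊤ := by
  rw [Ideal.eq_top_iff_one, Submodule.mem_sup, isUnit_iff_exists_inv]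
  constructor
  · rintro ⟨b, hb⟩
    obtain ⟨b, rfl⟩ := Ideal.Quotient.mk_surjective b
    rw [← map_mul, ← map_one (Ideal.Quotient.mk I), eq_comm, Ideal.Quotient.eq] at hb
    exact ⟨a * b, Ideal.mul_mem_right _ _ (Ideal.mem_span_singleton_self a), _, hb, by ring⟩
  · rintro ⟨_, hy, i, hi, h⟩
    obtain ⟨b, rfl⟩ := Ideal.mem_span_singleton'.1 hy
    refine ⟨Ideal.Quotient.mk I b, ?_⟩
    rw [← map_mul, ← map_one (Ideal.Quotient.mk I), eq_comm, Ideal.Quotient.eq, ← h]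
    convert hi using 1
    ring

end Units

/-! ### Orders: nonzero conductor, finite quotient, fraction field -/

section Order

open NumberField

variable {K : Type*} [Field K] [NumberField K] {R : Subring (𝓞 K)}

/-- Elements of `K` with a nonzero integer multiple in `R` are closed under sums and rational
multiples, so they exhaust the span of `R`. -/
theorem NumberField.IsOrderIn.exists_nat_mul_mem (hR : IsOrderIn K R) (x : 𝓞 K) :
    ∃ n : ℕ, n ≠ 0 ∧ n * x ∈ R := by
  suffices h : ∀ y : K, ∃ n : ℕ, n ≠ 0 ∧ ∃ r ∈ R, (n : K) * y = algebraMap (𝓞 K) K r by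
    obtain ⟨n, hn, r, hr, h⟩ := h (algebraMap (𝓞 K) K x)
    refine ⟨n, hn, ?_⟩
    rwa [show (n : 𝓞 K) * x = r from RingOfIntegers.coe_injective (by simpa using h)]
  intro y
  have hy : y ∈ Submodule.span ℚ (algebraMap (𝓞 K) K '' (R : Set (𝓞 K))) := by
    rw [hR]; exact Submodule.mem_top
  induction hy using Submodule.span_induction with
  | mem y hy =>
    obtain ⟨r, hr, rfl⟩ := hy
    exact ⟨1, one_ne_zero, r, hr, by simp⟩
  | zero => exact ⟨1, one_ne_zero, 0, R.zero_mem, by simp⟩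
  | add y z _ _ hy hz =>
    obtain ⟨n, hn, r, hr, hnr⟩ := hy
    obtain ⟨m, hm, s, hs, hms⟩ := hz
    refine ⟨n * m, mul_ne_zero hn hm, m * r + n * s,
      R.add_mem (R.mul_mem (natCast_mem R m) hr) (R.mul_mem (natCast_mem R n) hs), ?_⟩
    simp only [map_add, map_mul, map_natCast, ← hnr, ← hms]
    push_cast
    ring
  | smul q y _ hy =>
    obtain ⟨n, hn, r, hr, hnr⟩ := hy
    refine ⟨q.den * n, mul_ne_zero q.den_nz hn, q.num * r, R.mul_mem (intCast_mem R _) hr, ?_⟩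
    have hq : (q.den : K) * (q : K) = q.num := by
      rw [mul_comm]; exact_mod_cast congrArg (fun a : ℚ ↦ (a : K)) q.mul_den_eq_num
    simp only [map_mul, map_intCast, ← hnr, Algebra.smul_def, eq_ratCast, ← hq]
    push_cast
    ring

/-- The ring of integers is finitely generated over `ℤ`, so a product of denominators of the
generators works for every element. -/
theorem NumberField.IsOrderIn.exists_nat_mem_conductorIdeal (hR : IsOrderIn K R) :
    ∃ n : ℕ, n ≠ 0 ∧ (n : 𝓞 K) ∈ R.conductorIdeal := by
  obtain ⟨S, hS⟩ := Module.Finite.fg_top (R := ℤ) (M := 𝓞 K)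
  choose n hn hnR using hR.exists_nat_mul_mem
  refine ⟨∏ x ∈ S, n x, Finset.prod_ne_zero_iff.2 fun x _ ↦ hn x, fun y ↦ ?_⟩
  have hy : y ∈ Submodule.span ℤ (S : Set (𝓞 K)) := by rw [hS]; exact Submodule.mem_top
  induction hy using Submodule.span_induction with
  | mem x hx =>
    classical
    rw [← Finset.prod_erase_mul S n hx, Nat.cast_mul, mul_assoc]
    exact R.mul_mem (natCast_mem R _) (hnR x)
  | zero => simp
  | add x y _ _ hx hy => rw [mul_add]; exact R.add_mem hx hy
  | smul a x _ hx => rw [mul_smul_comm]; exact R.zsmul_mem hx a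

theorem NumberField.IsOrderIn.finite_quotient_conductorIdeal (hR : IsOrderIn K R) :
    Finite (𝓞 K ⧸ R.conductorIdeal) := by
  obtain ⟨n, hn, h⟩ := hR.exists_nat_mem_conductorIdeal
  refine Ideal.finiteQuotientOfFreeOfNeBot _ fun h0 ↦ hn ?_
  rw [h0, Ideal.mem_bot] at h
  exact_mod_cast h

theorem NumberField.IsOrderIn.isFractionRing (hR : IsOrderIn K R) : IsFractionRing R K := by
  obtain ⟨n, hn, h⟩ := hR.exists_nat_mem_conductorIdeal
  have hnK : (n : K) ≠ 0 := by exact_mod_cast hn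
  refine IsFractionRing.of_field R K fun z ↦ ?_
  obtain ⟨x, y, hy, rfl⟩ := IsFractionRing.div_surjective (A := 𝓞 K) z
  -- Scaling both terms of `x / y` by an integer of the conductor moves them into `R`.
  refine ⟨⟨n * x, h x⟩, ⟨n * y, h y⟩, ?_⟩
  change _ = algebraMap (𝓞 K) K (n * x) / algebraMap (𝓞 K) K (n * y)
  rw [map_mul, map_mul, map_natCast, mul_div_mul_left _ _ hnK]

end Order

/-! ### The unit-theoretic equivalences -/

section TFAE

variable {T : Type*} [CommRing T] (R : Subring T)

/-- An arbitrary isomorphism gives equal finite orders, which forces the canonical injection to be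
onto. -/
theorem Subring.isLocallyAssociated_iff_surjective [Finite (T ⧸ R.conductorIdeal)ˣ] :
    R.IsLocallyAssociated ↔ Function.Surjective R.unitsQuotientMap := by
  refine ⟨fun ⟨e⟩ ↦ ?_, fun h ↦ ⟨MulEquiv.ofBijective _ ⟨R.unitsQuotientMap_injective, h⟩⟩⟩
  exact ((Nat.bijective_iff_injective_and_card _).2
    ⟨R.unitsQuotientMap_injective, Nat.card_congr e.toEquiv⟩).2

/-- By Lagrange the quotient on the right is the order of the target of `unitsQuotientMap`. -/
theorem Subring.card_eq_div_iff_surjective [Finite (T ⧸ R.conductorIdeal)ˣ] :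
    (Nat.card (Tˣ ⧸ R.unitsSubgroup) : ℚ) = (Nat.card (T ⧸ R.conductorIdeal)ˣ : ℚ) /
      (Nat.card (R ⧸ R.conductorIdealBelow)ˣ : ℚ) ↔ Function.Surjective R.unitsQuotientMap := by
  have h0 : (Nat.card R.quotientUnitsSubgroup : ℚ) ≠ 0 := by
    exact_mod_cast Nat.card_pos.ne'
  rw [← R.card_quotientUnitsSubgroup,
    Subgroup.card_eq_card_quotient_mul_card_subgroup R.quotientUnitsSubgroup, Nat.cast_mul,
    mul_div_cancel_right₀ _ h0, Nat.cast_inj]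
  exact ⟨fun h ↦ ((Nat.bijective_iff_injective_and_card _).2 ⟨R.unitsQuotientMap_injective, h⟩).2,
    fun h ↦ Nat.card_congr (Equiv.ofBijective _ ⟨R.unitsQuotientMap_injective, h⟩)⟩

theorem Subring.exists_mul_unit_of_surjective (h : Function.Surjective R.unitsQuotientMap) {t : T}
    (ht : Ideal.span {t} ⊔ R.conductorIdeal = ⊤) :
    ∃ r : R, Ideal.span {r} ⊔ R.conductorIdealBelow = ⊤ ∧ ∃ u : Tˣ, t = (r : T) * u := by
  obtain ⟨c, hc⟩ := Ideal.Quotient.isUnit_mk_iff.2 ht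
  obtain ⟨u, hu⟩ := R.unitsQuotientMap_surjective_iff.1 h (QuotientGroup.mk c)
  obtain ⟨v, hv⟩ := QuotientGroup.eq.1 hu
  -- `u⁻¹ t` has its class in `U(R/I)`, so it lies in `R` itself and serves as `r`.
  have hvt : R.conductorQuotientMap v =
      Ideal.Quotient.mk R.conductorIdeal (((u⁻¹ : Tˣ) : T) * t) := by
    rw [map_mul, ← hc]
    exact congrArg Units.val hv
  have hmem := R.mem_of_conductorQuotientMap_eq_mk hvt
  refine ⟨⟨_, hmem⟩, Ideal.Quotient.isUnit_mk_iff.1 ?_, u, ?_⟩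
  · convert v.isUnit
    exact R.conductorQuotientMap_injective hvt.symm
  · linear_combination (-t) * u.inv_mul

theorem Subring.exists_mul_add_isUnit_of_forall_exists_mul_unit
    (h : ∀ t : T, Ideal.span {t} ⊔ R.conductorIdeal = ⊤ →
      ∃ r : R, Ideal.span {r} ⊔ R.conductorIdealBelow = ⊤ ∧ ∃ u : Tˣ, t = (r : T) * u)
    {t : T} (ht : IsUnit (Ideal.Quotient.mk R.conductorIdeal t)) :
    ∃ r : R, IsUnit (Ideal.Quotient.mk R.conductorIdealBelow r) ∧
      ∃ β ∈ R.conductorIdeal, IsUnit (t * (r : T) + β) := by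
  obtain ⟨r, hr, u, rfl⟩ := h t (Ideal.Quotient.isUnit_mk_iff.1 ht)
  obtain ⟨_, har, j, hj, h1⟩ := Submodule.mem_sup.1 ((Ideal.eq_top_iff_one _).1 hr)
  obtain ⟨a, rfl⟩ := Ideal.mem_span_singleton'.1 har
  -- `a` inverts `r` modulo `I`: multiplying `a r + j = 1` by `u` gives `(r u) a + u j = u`.
  refine ⟨a, Ideal.Quotient.isUnit_mk_iff.2 ?_, u * j, R.conductorIdeal.mul_mem_left _ hj, ?_⟩
  · rw [Ideal.eq_top_iff_one, ← h1]
    exact Ideal.add_mem _ (Ideal.mem_sup_left (Ideal.mul_mem_right _ _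
      (Ideal.mem_span_singleton_self a))) (Ideal.mem_sup_right hj)
  · convert u.isUnit using 1
    have h1' : (a : T) * r + j = 1 := congrArg Subtype.val h1
    linear_combination u * h1'

theorem Subring.unitsQuotientMap_surjective_of_forall_exists_mul_add_isUnit
    (h : ∀ t : T, IsUnit (Ideal.Quotient.mk R.conductorIdeal t) →
      ∃ r : R, IsUnit (Ideal.Quotient.mk R.conductorIdealBelow r) ∧
        ∃ β ∈ R.conductorIdeal, IsUnit (t * (r : T) + β)) :
    Function.Surjective R.unitsQuotientMap := by
  rw [unitsQuotientMap_surjective_iff]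
  rintro ⟨c⟩
  obtain ⟨t, ht⟩ := Ideal.Quotient.mk_surjective (c : T ⧸ R.conductorIdeal)
  obtain ⟨r, ⟨v, hv⟩, β, hβ, ⟨u, hu⟩⟩ := h t (ht ▸ c.isUnit)
  refine ⟨u, Eq.symm (QuotientGroup.eq.2 ⟨v, ?_⟩)⟩
  rw [eq_inv_mul_iff_mul_eq]
  ext1
  change (c : T ⧸ R.conductorIdeal) * R.conductorQuotientMap v =
    Ideal.Quotient.mk R.conductorIdeal u
  rw [← ht, hv]
  change Ideal.Quotient.mk R.conductorIdeal t * Ideal.Quotient.mk R.conductorIdeal r = _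
  rw [hu, ← map_mul, Ideal.Quotient.eq]
  simpa using hβ

end TFAE

theorem mainTheorem12 (K : Type*) [Field K] [NumberField K]
    (R : Subring (NumberField.RingOfIntegers K)) (hR : NumberField.IsOrderIn K R) :
    -- all the groups whose orders are compared below are finite
    (Finite ((NumberField.RingOfIntegers K)ˣ ⧸ R.unitsSubgroup) ∧
      Finite (NumberField.RingOfIntegers K ⧸ R.conductorIdeal)ˣ ∧
      Finite (R ⧸ R.conductorIdealBelow)ˣ ∧
      Finite (ClassGroup (NumberField.RingOfIntegers K)) ∧
      Finite (ClassGroup R)) ∧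
    List.TFAE [
      -- U(T)/U(R) is isomorphic to U(T/I)/U(R/I), for T the ring of integers
      R.IsLocallyAssociated,
      -- every coset contains the class of a unit
      ∀ c : (NumberField.RingOfIntegers K ⧸ R.conductorIdeal)ˣ ⧸ R.quotientUnitsSubgroup,
        ∃ u : (NumberField.RingOfIntegers K)ˣ,
          QuotientGroup.mk (Units.map (Ideal.Quotient.mk R.conductorIdeal :
            NumberField.RingOfIntegers K →* NumberField.RingOfIntegers K ⧸ R.conductorIdeal) u)
            = c,
      -- the same in terms of elements
      ∀ t : NumberField.RingOfIntegers K, IsUnit (Ideal.Quotient.mk R.conductorIdeal t) →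
        ∃ r : R, IsUnit (Ideal.Quotient.mk R.conductorIdealBelow r) ∧
          ∃ β ∈ R.conductorIdeal, IsUnit (t * (r : NumberField.RingOfIntegers K) + β),
      -- factorization of the elements relatively prime to the conductor
      ∀ t : NumberField.RingOfIntegers K, Ideal.span {t} ⊔ R.conductorIdeal = ⊤ →
        ∃ r : R, Ideal.span {r} ⊔ R.conductorIdealBelow = ⊤ ∧
          ∃ u : (NumberField.RingOfIntegers K)ˣ, t = (r : NumberField.RingOfIntegers K) * u,
      -- comparison of the orders of the unit groups
      (Nat.card ((NumberField.RingOfIntegers K)ˣ ⧸ R.unitsSubgroup) : ℚ) =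
        (Nat.card (NumberField.RingOfIntegers K ⧸ R.conductorIdeal)ˣ : ℚ) /
          (Nat.card (R ⧸ R.conductorIdealBelow)ˣ : ℚ),
      -- equality of the class numbers
      Nat.card (ClassGroup (NumberField.RingOfIntegers K)) = Nat.card (ClassGroup R),
      -- isomorphism of the class groups
      Nonempty (ClassGroup (NumberField.RingOfIntegers K) ≃* ClassGroup R)] := by
  have hfin := hR.finite_quotient_conductorIdeal
  have := hR.isFractionRing
  have hI : ∀ a ∈ R.conductorIdeal, a ∈ R := fun a ↦ R.mem_of_mem_conductorIdeal
  have hfinR : Finite (R ⧸ R.conductorIdealBelow) :=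
    Finite.of_injective _ R.conductorQuotientMap_injective
  have hCl : Finite (ClassGroup R) := Subring.finite_classGroup K hI
  refine ⟨⟨Finite.of_injective _ R.unitsQuotientMap_injective, inferInstance, inferInstance,
    inferInstance, hCl⟩, ?_⟩
  have hinj := Subring.classGroupMap_injective_iff K hI
  have hsurj := Subring.classGroupMap_surjective K hI
  tfae_have 1 ↔ 2 :=
    R.isLocallyAssociated_iff_surjective.trans R.unitsQuotientMap_surjective_iff
  tfae_have 5 ↔ 2 := R.card_eq_div_iff_surjective.trans R.unitsQuotientMap_surjective_iff
  tfae_have 2 → 4 := fun h _ ht ↦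
    R.exists_mul_unit_of_surjective (R.unitsQuotientMap_surjective_iff.2 h) ht
  tfae_have 4 → 3 := fun h _ ht ↦ R.exists_mul_add_isUnit_of_forall_exists_mul_unit h ht
  tfae_have 3 → 2 := fun h ↦ R.unitsQuotientMap_surjective_iff.1
    (R.unitsQuotientMap_surjective_of_forall_exists_mul_add_isUnit h)
  tfae_have 4 → 7 := fun h ↦ ⟨(MulEquiv.ofBijective _ ⟨hinj.2 h, hsurj⟩).symm⟩
  tfae_have 7 → 6 := fun ⟨e⟩ ↦ Nat.card_congr e.toEquiv
  -- A surjection between finite groups of equal order is injective.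
  tfae_have 6 → 4 := fun h ↦
    hinj.1 ((Nat.bijective_iff_surjective_and_card _).2 ⟨hsurj, h.symm⟩).1
  tfae_finish
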